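/- Let $r\ge 1$ be an integer. For $p\in(0,1)$ let $N$ be the number of Bernoulli($p$) trials needed to obtain $r$ successes, so that $f(n)=\Pr[N=n]=\binom{n-1}{r-1}p^r(1-p)^{n-r}$ for $n\ge r$. A (possibly randomized) estimator based on inverse binomial sampling assigns to each $n\ge r$ a probability distribution $\Pi_n$ on $(0,\infty)$, the conditional distribution of the estimator given $N=n$; a non-randomized estimator $g(N)$, with $g:\{r,r+1,\dots\}\to(0,\infty)$, is the case in which $\Pi_n$ is the point mass at $g(n)$. For a loss function $L:(0,\infty)\to[0,\infty)$ the risk is $$\eta(p)=\sum_{n=r}^\infty f(n)\int_0^\infty L(y/p)\,\mathrm d\Pi_n(y)\in[0,\infty],$$ which for a non-randomized estimator is $\sum_{n=r}^\infty f(n)L(g(n)/p)$. Assume that: 1. $L$ is of bounded variation on $[x_1,x_2]$ whenever $0<x_1<x_2$. 2. $L$ has finitely many discontinuities in $(0,\infty)$. 3. There are real numbers $K<r$ and $K'<r$ such that $L(x)=\Theta(x^{K})$ as $x\to0^+$ and $L(x)=\Theta(x^{K'})$ as $x\to\infty$. 4. There is $\xi>0$ such that $L$ is non-increasing on $(0,\xi)$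 and $\int_\xi^\infty \frac{L(\xi)-L(x)}{x^{r+1}}\,\mathrm dx>0$. 5. There is $\xi'>0$ such that $L$ is non-decreasing on $(\xi',\infty)$ and either (i) $L(\xi'-)<L(\xi'+)$ (one-sided limits), or (ii) there is an integer $t\ge1$ such that $L$ is of class $C^t$ on an open interval containing $\xi'$, $L^{(i)}(\xi')=0$ for $1\le i\le t-1$, and $(-1)^{t-1}L^{(t)}(\xi')>0$. Let $\Omega^*\in(0,\infty)$ be any value that minimizes $$\bar\eta(\Omega)=\int_0^\infty \frac{\nu^{r-1}e^{-\nu}}{(r-1)!}\,L(\Omega/\nu)\,\mathrm d\nu$$ over all $\Omega\in(0,\infty)$. Then every non-randomized estimator $g:\{r,r+1,\dots\}\to(0,\infty)$ with $\lim_{n\to\infty} n\,g(n)=\Omega^*$ minimizes $\limsup_{p\to0}\eta(p)$ among all (possibly randomized) estimators based on inverse binomial sampling. -/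

import Mathlib

open MeasureTheory Filter Topology
open scoped ENNReal

namespace InverseBinomial

noncomputable section

/-- Probability that exactly `n` Bernoulli trials with success probability `p` are needed in order
to obtain `r` successes (used for `n ≥ r ≥ 1`); here
`(n - 1).choose (r - 1) = (n - 1)(n - 2)⋯(n - r + 1) / (r - 1)!`. -/
def trialsPMF (r : ℕ) (p : ℝ) (n : ℕ) : ℝ :=
  ((n - 1).choose (r - 1) : ℝ) * p ^ r * (1 - p) ^ (n - r)

/-- A non-randomized estimator `g(N)`: a positive function on `{r, r + 1, …}`
(values at `n < r` are never used). -/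
def IsNonrandomizedEstimator (r : ℕ) (g : ℕ → ℝ) : Prop :=
  ∀ n, r ≤ n → 0 < g n

/-- A (possibly) randomized estimator: for each `n ≥ r` the conditional distribution `G n`, given
`N = n`, of a positive random variable (values at `n < r` are never used). -/
def IsEstimator (r : ℕ) (G : ℕ → Measure ℝ) : Prop :=
  ∀ n, r ≤ n → IsProbabilityMeasure (G n) ∧ G n (Set.Iic 0) = 0

/-- Risk `η(p) = ∑_{n ≥ r} f(n) ∫_0^∞ L(y / p) dΠ_n(y)` of a randomized estimator, for the
non-negative loss function `L`; it may be infinite. -/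
def risk (r : ℕ) (L : ℝ → ℝ) (G : ℕ → Measure ℝ) (p : ℝ) : ℝ≥0∞ :=
  ∑' n : Set.Ici r, ENNReal.ofReal (trialsPMF r p n) *
    ∫⁻ y in Set.Ioi 0, ENNReal.ofReal (L (y / p)) ∂(G n)

/-- Risk `η(p) = ∑_{n ≥ r} f(n) L(g(n) / p)` of a non-randomized estimator. -/
def nonrandomizedRisk (r : ℕ) (L : ℝ → ℝ) (g : ℕ → ℝ) (p : ℝ) : ℝ≥0∞ :=
  ∑' n : Set.Ici r, ENNReal.ofReal (trialsPMF r p n) * ENNReal.ofReal (L (g n / p))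

/-- A non-randomized estimator is the randomized estimator given by point masses. -/
theorem IsNonrandomizedEstimator.isEstimator_dirac {r : ℕ} {g : ℕ → ℝ}
    (hg : IsNonrandomizedEstimator r g) : IsEstimator r (fun n => Measure.dirac (g n)) := by
  intro n hn
  refine ⟨inferInstance, ?_⟩
  rw [Measure.dirac_apply' _ measurableSet_Iic]
  simp [hg n hn]

theorem risk_dirac {r : ℕ} {g : ℕ → ℝ} (hg : IsNonrandomizedEstimator r g) (L : ℝ → ℝ) (p : ℝ) :
    risk r L (fun n => Measure.dirac (g n)) p = nonrandomizedRisk r L g p := by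
  classical
  unfold risk nonrandomizedRisk
  refine tsum_congr fun n => ?_
  rw [restrict_dirac' measurableSet_Ioi, if_pos (Set.mem_Ioi.2 (hg n n.2)), lintegral_dirac]

/-- The asymptotic quality measure `limsup_{p → 0} η(p)`. -/
def limsupAtZero (η : ℝ → ℝ≥0∞) : ℝ≥0∞ := limsup η (𝓝[>] 0)

/-- `L` has bounded variation on every `[x₁, x₂]` with `0 < x₁ < x₂`. -/
def HasLocallyBoundedVariation (L : ℝ → ℝ) : Prop :=
  ∀ x₁ x₂ : ℝ, 0 < x₁ → x₁ < x₂ → BoundedVariationOn L (Set.Icc x₁ x₂)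

/-- `L` has finitely many discontinuities in `(0, ∞)`. -/
def HasFinitelyManyDiscontinuities (L : ℝ → ℝ) : Prop :=
  {x : ℝ | 0 < x ∧ ¬ ContinuousAt L x}.Finite

/-- `L(x)` is `Θ(x^K)` as `x → 0+` for some `K < r`, and `Θ(x^K')` as `x → ∞` for some
`K' < r`. -/
def HasThetaGrowth (r : ℕ) (L : ℝ → ℝ) : Prop :=
  (∃ K : ℝ, K < r ∧ Asymptotics.IsTheta (𝓝[>] (0 : ℝ)) L (fun x => x ^ K)) ∧
  (∃ K' : ℝ, K' < r ∧ Asymptotics.IsTheta atTop L (fun x : ℝ => x ^ K'))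

/-- `L` is non-increasing on some `(0, ξ)`, with `∫_ξ^∞ (L(ξ) - L(x)) / x^(r+1) dx > 0`. -/
def HasDecreasingStart (r : ℕ) (L : ℝ → ℝ) : Prop :=
  ∃ ξ : ℝ, 0 < ξ ∧ AntitoneOn L (Set.Ioo 0 ξ) ∧
    0 < ∫ x in Set.Ioi ξ, (L ξ - L x) / x ^ (r + 1)

/-- `L` is non-decreasing on some `(ξ, ∞)`, and at `ξ` either it jumps upwards or it is `C^t` with
first non-vanishing derivative of order `t ≥ 1`, for which `(-1)^(t-1) L^(t)(ξ) > 0`. -/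
def HasIncreasingEnd (L : ℝ → ℝ) : Prop :=
  ∃ ξ : ℝ, 0 < ξ ∧ MonotoneOn L (Set.Ioi ξ) ∧
    ((∃ a b : ℝ, Tendsto L (𝓝[<] ξ) (𝓝 a) ∧ Tendsto L (𝓝[>] ξ) (𝓝 b) ∧ a < b) ∨
     (∃ t : ℕ, 1 ≤ t ∧ ContDiffAt ℝ t L ξ ∧
        (∀ i : ℕ, 1 ≤ i → i < t → iteratedDeriv i L ξ = 0) ∧
        0 < (-1 : ℝ) ^ (t - 1) * iteratedDeriv t L ξ))

/-- `φ(ν) = ν^(r-1) e^(-ν) / (r-1)!`. -/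
def gammaDensity (r : ℕ) (ν : ℝ) : ℝ :=
  ν ^ (r - 1) * Real.exp (-ν) / ((r - 1).factorial : ℝ)

/-- `η̄(Ω) = ∫_0^∞ φ(ν) L(Ω / ν) dν`, the asymptotic risk associated with `Ω`. -/
def asymptoticRisk (r : ℕ) (L : ℝ → ℝ) (Ω : ℝ) : ℝ≥0∞ :=
  ∫⁻ ν in Set.Ioi 0, ENNReal.ofReal (gammaDensity r ν * L (Ω / ν))

/-- `Ω ∈ (0, ∞)` is optimal if it minimizes the asymptotic risk over `(0, ∞)`. -/
def IsOptimal (r : ℕ) (L : ℝ → ℝ) (Ω : ℝ) : Prop :=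
  0 < Ω ∧ IsMinOn (asymptoticRisk r L) (Set.Ioi 0) Ω

end

end InverseBinomial

/-!
As `p → 0`, the variable `p N` converges to a gamma distribution with density `φ`, even in the sense
that `f(n) / p → φ(ν)` whenever `n → ∞` and `n p → ν` (`tendsto_trialsPMF_div`). Writing the risk as
an integral over `ν = n p` and applying dominated convergence, the risk of an estimator `g` with
`n g(n) → Ω` converges to the asymptotic risk of `Ω` (`tendsto_nonrandomizedRisk`). The growth
exponent `K' < r` makes the dominating function integrable near `ν = 0`.

It remains to show that no estimator has a limit superior below the minimum `η*` of the asymptotic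
risk. Average the risk over `p` with respect to the scale-invariant prior `dp / p`. Given `N = n`, an
estimate `y` contributes, after the substitution `p = ν / n`, about `1 / n` times the asymptotic
risk of `n y`, hence at least about `η* / n`. Summing over `A ≤ n < N` gives about `η* log (N / A)`,
and the mass of the prior on the range of `p` involved is `log (N / A)` up to a constant
(`le_limsup_risk`). Randomization plays no role, because the bound holds for every single `y`.

For this argument the range of `ν` has to be truncated to `[1/M, M]`, at an arbitrarily small cost,
uniformly in the estimate and in `n` (`exists_uniform_truncation`). If this failed, there would be values `Ω_k`,
converging in `[0, ∞]` along a subsequence, that violate the bound, and Fatou's lemma would give a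
limiting risk below `η*`. For a limit in `(0, ∞)` this contradicts the minimality of `η*`. For the
limits `0` and `∞` the limiting risk is the limit of the loss function at that end, which exists by
monotonicity, and which is at least `η*` because the asymptotic risk has the same limit
(`tendsto_asymptoticRisk`).
-/

namespace InverseBinomial

/-! ### The loss function as a measurable extended non-negative function -/

/-- The loss function with values in `[0, ∞]`, set to zero outside `(0, ∞)`: the values of `L` there
are irrelevant to the risk, but could spoil measurability. -/
noncomputable def posLoss (L : ℝ → ℝ) (x : ℝ) : ℝ≥0∞ :=
  ENNReal.ofReal ((Set.Ioi 0).indicator L x)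

theorem posLoss_of_pos (L : ℝ → ℝ) {x : ℝ} (hx : 0 < x) : posLoss L x = ENNReal.ofReal (L x) := by
  simp [posLoss, hx]

theorem measurable_posLoss {L : ℝ → ℝ} (h : HasFinitelyManyDiscontinuities L) :
    Measurable (posLoss L) := by
  classical
  set D := {x : ℝ | 0 < x ∧ ¬ ContinuousAt L x} with hD
  have hDm : MeasurableSet D := h.measurableSet
  have hT : MeasurableSet (Set.Ioi (0 : ℝ) \ D) := measurableSet_Ioi.diff hDm
  have hc : ContinuousOn L (Set.Ioi (0 : ℝ) \ D) := by
    rintro x ⟨hx, hxD⟩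
    have : ContinuousAt L x := by
      by_contra hcon
      exact hxD ⟨hx, hcon⟩
    exact this.continuousWithinAt
  have hm : Measurable ((Set.Ioi (0 : ℝ) \ D).indicator L) := by
    rw [← Set.piecewise_eq_indicator]
    exact hc.measurable_piecewise continuousOn_const hT
  refine ENNReal.measurable_ofReal.comp (hm.measurable_of_countable_ne (h.countable.mono ?_))
  intro x hx
  by_contra hxD
  apply hx
  by_cases h0 : 0 < x
  · rw [Set.indicator_of_mem (show x ∈ Set.Ioi (0 : ℝ) \ D from ⟨h0, hxD⟩),
      Set.indicator_of_mem (show x ∈ Set.Ioi (0 : ℝ) from h0)]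
  · rw [Set.indicator_of_notMem (fun hh => h0 hh.1),
      Set.indicator_of_notMem (show x ∉ Set.Ioi (0 : ℝ) from h0)]

theorem tendsto_posLoss {L : ℝ → ℝ} {x : ℝ} (hx : 0 < x) (h : ContinuousAt L x) :
    Tendsto (posLoss L) (𝓝 x) (𝓝 (posLoss L x)) := by
  rw [posLoss_of_pos L hx]
  refine Tendsto.congr' ?_ ((ENNReal.continuous_ofReal.tendsto _).comp h)
  filter_upwards [Ioi_mem_nhds hx] with y hy
  exact (posLoss_of_pos L hy).symm

/-- For almost every `ν`, the loss function is continuous at `Ω / ν`. -/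
theorem ae_continuousAt_div {L : ℝ → ℝ} (h : HasFinitelyManyDiscontinuities L) {Ω : ℝ}
    (hΩ : 0 < Ω) : ∀ᵐ ν ∂(volume.restrict (Set.Ioi (0 : ℝ))), ContinuousAt L (Ω / ν) := by
  rw [ae_restrict_iff' measurableSet_Ioi]
  have : ((fun x => Ω / x) '' {x : ℝ | 0 < x ∧ ¬ ContinuousAt L x}).Finite := h.image _
  filter_upwards [this.countable.ae_notMem volume] with ν hν hpos
  by_contra hcon
  have hpos : 0 < ν := hpos
  exact hν ⟨Ω / ν, ⟨by positivity, hcon⟩, by field_simp⟩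

/-! ### Power bounds for the loss function -/

/-- Bounded variation serves only to bound the loss function on compact subsets of `(0, ∞)`, where
neither growth condition applies. -/
theorem exists_power_bound {L : ℝ → ℝ} (hvar : HasLocallyBoundedVariation L) {a b : ℝ}
    (ha : 0 ≤ a) (hb : 0 ≤ b) (h0 : L =O[𝓝[>] 0] fun x => x ^ (-a))
    (h1 : L =O[atTop] fun x => x ^ b) :
    ∃ C : ℝ, 0 ≤ C ∧ ∀ x, 0 < x → L x ≤ C * (x ^ (-a) + x ^ b) := by
  obtain ⟨c0, hc0, h0⟩ := h0.exists_pos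
  obtain ⟨c1, hc1, h1⟩ := h1.exists_pos
  obtain ⟨δ, hδ, h0⟩ := (nhdsGT_basis (0 : ℝ)).eventually_iff.1 h0.bound
  obtain ⟨N, h1⟩ := eventually_atTop.1 h1.bound
  set y := δ / 2
  have hy : 0 < y := by positivity
  set z := max N (y + 1)
  have hyz : y < z := lt_of_lt_of_le (by linarith) (le_max_right _ _)
  set B := |L y| + (eVariationOn L (Set.Icc y z)).toReal
  have hB : 0 ≤ B := by positivity
  refine ⟨c0 + c1 + B, by positivity, fun x hx => ?_⟩
  have hxa : 0 < x ^ (-a) := Real.rpow_pos_of_pos hx _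
  have hxb : 0 < x ^ b := Real.rpow_pos_of_pos hx _
  have hone : 1 ≤ x ^ (-a) + x ^ b := by
    rcases le_total x 1 with h | h
    · have := Real.one_le_rpow_of_pos_of_le_one_of_nonpos hx h (neg_nonpos.2 ha)
      linarith
    · have := Real.one_le_rpow h hb
      linarith
  rcases lt_or_ge x δ with hxδ | hxδ
  · have := h0 ⟨hx, hxδ⟩
    rw [Real.norm_eq_abs, Real.norm_of_nonneg hxa.le] at this
    have := le_of_abs_le this
    nlinarith [mul_nonneg hB hxa.le, mul_nonneg hB hxb.le, mul_pos hc1 hxa, mul_pos hc1 hxb,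
      mul_pos hc0 hxb]
  · rcases le_or_gt N x with hxN | hxN
    · have := h1 x hxN
      rw [Real.norm_eq_abs, Real.norm_of_nonneg hxb.le] at this
      have := le_of_abs_le this
      nlinarith [mul_nonneg hB hxa.le, mul_nonneg hB hxb.le, mul_pos hc1 hxa, mul_pos hc0 hxa,
        mul_pos hc0 hxb]
    · have hyx : y ≤ x := by simp only [y]; linarith
      have := (hvar y z hy hyz).sub_le (x := x) (y := y)
        ⟨hyx, hxN.le.trans (le_max_left _ _)⟩ ⟨le_rfl, hyz.le⟩
      have h2 : L x ≤ B := by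
        have := le_abs_self (L y)
        simp only [B]
        linarith
      calc L x ≤ B * 1 := by linarith
        _ ≤ (c0 + c1 + B) * (x ^ (-a) + x ^ b) := by
          apply mul_le_mul _ hone zero_le_one (by positivity)
          linarith

theorem HasThetaGrowth.isBigO_zero {r : ℕ} {L : ℝ → ℝ} (h : HasThetaGrowth r L) :
    ∃ a : ℝ, 0 ≤ a ∧ L =O[𝓝[>] 0] fun x => x ^ (-a) := by
  obtain ⟨⟨K, -, hK⟩, -⟩ := h
  refine ⟨max (-K) 0, le_max_right _ _, hK.1.trans (Asymptotics.IsBigO.of_bound 1 ?_)⟩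
  filter_upwards [Ioo_mem_nhdsGT (zero_lt_one (α := ℝ))] with x hx
  rw [Real.norm_of_nonneg (Real.rpow_nonneg hx.1.le _),
    Real.norm_of_nonneg (Real.rpow_nonneg hx.1.le _), one_mul]
  refine Real.rpow_le_rpow_of_exponent_ge hx.1 hx.2.le ?_
  have := le_max_left (-K) 0
  linarith

theorem HasThetaGrowth.isBigO_atTop {r : ℕ} (hr : 1 ≤ r) {L : ℝ → ℝ} (h : HasThetaGrowth r L) :
    ∃ b : ℝ, 0 ≤ b ∧ b < r ∧ L =O[atTop] fun x => x ^ b := by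
  obtain ⟨-, ⟨K, hKr, hK⟩⟩ := h
  refine ⟨max K 0, le_max_right _ _, max_lt hKr (by exact_mod_cast hr),
    hK.1.trans (Asymptotics.IsBigO.of_bound 1 ?_)⟩
  filter_upwards [eventually_ge_atTop 1] with x hx
  have hx0 : 0 ≤ x := by linarith
  rw [Real.norm_of_nonneg (Real.rpow_nonneg hx0 _),
    Real.norm_of_nonneg (Real.rpow_nonneg hx0 _), one_mul]
  exact Real.rpow_le_rpow_of_exponent_le hx (le_max_left _ _)

theorem exists_tendsto_posLoss_zero {r : ℕ} {L : ℝ → ℝ} (h : HasDecreasingStart r L) :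
    ∃ l, Tendsto (posLoss L) (𝓝[>] 0) (𝓝 l) := by
  obtain ⟨ξ, hξ, hL, -⟩ := h
  have hanti : AntitoneOn (posLoss L) (Set.Ioo 0 ξ) := by
    intro x hx y hy hxy
    rw [posLoss_of_pos L hx.1, posLoss_of_pos L hy.1]
    exact ENNReal.ofReal_le_ofReal (hL hx hy hxy)
  exact ⟨_, hanti.tendsto_nhdsWithin_Ioo_right ⟨ξ / 2, by simpa using hξ⟩ (OrderTop.bddAbove _)⟩

theorem exists_tendsto_posLoss_atTop {L : ℝ → ℝ} (h : HasIncreasingEnd L) :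
    ∃ l, Tendsto (posLoss L) atTop (𝓝 l) := by
  obtain ⟨ξ, hξ, hL, -⟩ := h
  have hmono : Monotone fun x => posLoss L (max x (ξ + 1)) := by
    intro x y hxy
    have hx : ξ < max x (ξ + 1) := lt_of_lt_of_le (by linarith) (le_max_right _ _)
    have hy : ξ < max y (ξ + 1) := lt_of_lt_of_le (by linarith) (le_max_right _ _)
    simp only [posLoss_of_pos L (hξ.trans hx), posLoss_of_pos L (hξ.trans hy)]
    exact ENNReal.ofReal_le_ofReal (hL hx hy (max_le_max hxy le_rfl))
  refine ⟨_, (tendsto_atTop_iSup hmono).congr' ?_⟩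
  filter_upwards [eventually_ge_atTop (ξ + 1)] with x hx
  rw [max_eq_left hx]

/-- If the loss function has a finite limit along a filter `l` of positive numbers, it is bounded
there. -/
theorem isBigO_one_of_tendsto_posLoss {L : ℝ → ℝ} (hL : ∀ x, 0 < x → 0 ≤ L x) {l : Filter ℝ}
    (hl : ∀ᶠ x in l, 0 < x) {c : ℝ≥0∞} (hc : c ≠ ⊤) (h : Tendsto (posLoss L) l (𝓝 c)) :
    L =O[l] fun x => x ^ (0 : ℝ) := by
  refine Asymptotics.IsBigO.of_bound (c + 1).toReal ?_
  filter_upwards [hl, h.eventually (Iio_mem_nhds (ENNReal.lt_add_right hc one_ne_zero))]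
    with x hx hx2
  rw [Real.rpow_zero, norm_one, mul_one, Real.norm_of_nonneg (hL x hx)]
  rw [posLoss_of_pos L hx] at hx2
  exact (ENNReal.ofReal_le_iff_le_toReal (by simp [hc])).1 hx2.le

/-! ### The limiting gamma density -/

theorem gammaDensity_pos {r : ℕ} {ν : ℝ} (hν : 0 < ν) : 0 < gammaDensity r ν := by
  unfold gammaDensity
  positivity

theorem measurable_gammaDensity (r : ℕ) : Measurable (gammaDensity r) := by
  unfold gammaDensity
  fun_prop

theorem lintegral_gammaDensity {r : ℕ} (hr : 1 ≤ r) :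
    ∫⁻ ν in Set.Ioi 0, ENNReal.ofReal (gammaDensity r ν) = 1 := by
  obtain ⟨k, rfl⟩ : ∃ k, r = k + 1 := ⟨r - 1, by omega⟩
  have hg := Real.Gamma_nat_eq_factorial k
  have hk : (0 : ℝ) < k + 1 := by positivity
  rw [Real.Gamma_eq_integral hk] at hg
  have hint : IntegrableOn (gammaDensity (k + 1)) (Set.Ioi 0) := by
    refine IntegrableOn.congr_fun
      ((Real.GammaIntegral_convergent hk).div_const (k.factorial : ℝ)) ?_ measurableSet_Ioi
    intro x _
    simp [gammaDensity, mul_comm]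
  rw [← ofReal_integral_eq_lintegral_ofReal hint
    ((ae_restrict_iff' measurableSet_Ioi).2 (ae_of_all _ fun x hx => (gammaDensity_pos hx).le))]
  have : ∫ x in Set.Ioi 0, gammaDensity (k + 1) x = 1 := by
    calc ∫ x in Set.Ioi 0, gammaDensity (k + 1) x
        = ∫ x in Set.Ioi 0, Real.exp (-x) * x ^ ((k : ℝ) + 1 - 1) / (k.factorial : ℝ) := by
          refine setIntegral_congr_fun measurableSet_Ioi fun x _ => ?_
          simp [gammaDensity, mul_comm]
      _ = 1 := by
          rw [integral_div, hg, div_self (by positivity)]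
  rw [this, ENNReal.ofReal_one]

/-- Finiteness of the integral that dominates the risks. The exponent `b < r` is the growth
exponent of the loss function at infinity. -/
theorem lintegral_gammaDensity_mul_rpow_ne_top {r : ℕ} (hr : 1 ≤ r) {a b : ℝ} (ha : 0 ≤ a)
    (hb : b < r) (A B : ℝ) :
    ∫⁻ ν in Set.Ioi 0, ENNReal.ofReal (gammaDensity r ν * (A * ν ^ a + B * ν ^ (-b))) ≠ ⊤ := by
  obtain ⟨k, rfl⟩ : ∃ k, r = k + 1 := ⟨r - 1, by omega⟩
  push_cast at hb
  have h1 := Real.GammaIntegral_convergent (s := k + 1 + a) (by positivity)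
  have h2 := Real.GammaIntegral_convergent (s := k + 1 - b) (by linarith)
  have h3 := ((h1.const_mul A).add (h2.const_mul B)).div_const (k.factorial : ℝ)
  refine ne_of_lt (IntegrableOn.setLIntegral_lt_top (IntegrableOn.congr_fun h3 ?_ measurableSet_Ioi))
  intro x hx
  have hx : 0 < x := hx
  have e1 : x ^ ((k : ℝ) + 1 + a - 1) = x ^ k * x ^ a := by
    rw [← Real.rpow_natCast, ← Real.rpow_add hx]; ring_nf
  have e2 : x ^ ((k : ℝ) + 1 - b - 1) = x ^ k * x ^ (-b) := by
    rw [← Real.rpow_natCast, ← Real.rpow_add hx]; ring_nf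
  simp only [gammaDensity, Pi.add_apply, e1, e2, Nat.add_sub_cancel]
  ring

theorem asymptoticRisk_eq (r : ℕ) (L : ℝ → ℝ) {Ω : ℝ} (hΩ : 0 < Ω) :
    asymptoticRisk r L Ω =
      ∫⁻ ν in Set.Ioi 0, ENNReal.ofReal (gammaDensity r ν) * posLoss L (Ω / ν) := by
  refine setLIntegral_congr_fun measurableSet_Ioi fun ν hν => ?_
  have hν : 0 < ν := hν
  simp only [posLoss_of_pos L (div_pos hΩ hν)]
  rw [ENNReal.ofReal_mul (gammaDensity_pos hν).le]

/-! ### Convergence of the rescaled number of trials -/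

theorem measurable_trialsPMF_div (r n : ℕ) : Measurable fun p => trialsPMF r p n / p := by
  unfold trialsPMF
  fun_prop

theorem tendsto_choose_div_pow (k : ℕ) :
    Tendsto (fun n : ℕ => (n.choose k : ℝ) / (n : ℝ) ^ k) atTop (𝓝 (1 / (k.factorial : ℝ))) := by
  induction k with
  | zero => simp
  | succ k ih =>
    have h2 : Tendsto (fun n : ℕ => 1 - (k : ℝ) / (n : ℝ)) atTop (𝓝 (1 - 0)) :=
      tendsto_const_nhds.sub (tendsto_const_div_atTop_nhds_zero_nat _)
    have h3 := (ih.mul h2).div_const ((k : ℝ) + 1)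
    have e : 1 / (k.factorial : ℝ) * (1 - 0) / ((k : ℝ) + 1) = 1 / ((k + 1).factorial : ℝ) := by
      rw [Nat.factorial_succ]; push_cast; field_simp; ring
    rw [e] at h3
    refine h3.congr' ?_
    filter_upwards [eventually_ge_atTop (k + 1)] with n hn
    have hc : (n.choose (k + 1) : ℝ) * (k + 1) = n.choose k * (n - k) := by
      have := Nat.choose_succ_right_eq n k
      rw [← Nat.cast_sub (by omega : k ≤ n)]
      exact_mod_cast this
    have hn0 : (n : ℝ) ≠ 0 := by
      have : n ≠ 0 := by omega
      exact_mod_cast this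
    have hk0 : (k : ℝ) + 1 ≠ 0 := by positivity
    rw [div_mul_eq_mul_div, div_div, div_eq_div_iff (by positivity) (by positivity)]
    field_simp
    rw [pow_succ]
    linear_combination (-(n : ℝ) ^ k * n) * hc

/-- If `n → ∞` and `n p → ν`, then `(1 - p)^n → e^(-ν)`. -/
theorem tendsto_one_sub_pow_exp {ι : Type*} {l : Filter ι} {n : ι → ℕ} {p : ι → ℝ} {ν : ℝ}
    (hp : Tendsto p l (𝓝[>] 0)) (hnp : Tendsto (fun i => (n i : ℝ) * p i) l (𝓝 ν)) :
    Tendsto (fun i => (1 - p i) ^ (n i)) l (𝓝 (Real.exp (-ν))) := by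
  have hp0 : Tendsto p l (𝓝 0) := hp.mono_right nhdsWithin_le_nhds
  -- Squeeze by `exp (-p / (1 - p)) ≤ 1 - p ≤ exp (-p)`.
  have hlow : Tendsto (fun i => Real.exp (-((n i : ℝ) * p i) / (1 - p i))) l
      (𝓝 (Real.exp (-ν))) := by
    have h1 : Tendsto (fun i => 1 - p i) l (𝓝 (1 - 0)) := tendsto_const_nhds.sub hp0
    have := (Real.continuous_exp.tendsto _).comp (hnp.neg.div h1 (by norm_num))
    rw [sub_zero, div_one] at this
    exact this
  have hupp : Tendsto (fun i => Real.exp (-((n i : ℝ) * p i))) l (𝓝 (Real.exp (-ν))) :=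
    (Real.continuous_exp.tendsto _).comp hnp.neg
  have hsmall : ∀ᶠ i in l, p i < 1 := hp0.eventually (Iio_mem_nhds one_pos)
  refine tendsto_of_tendsto_of_tendsto_of_le_of_le' hlow hupp ?_ ?_
  · filter_upwards [hsmall] with i hi
    have h1 : 0 < 1 - p i := by linarith
    have hlog := Real.one_sub_inv_le_log_of_pos h1
    rw [← Real.exp_log (pow_pos h1 _), Real.log_pow]
    apply Real.exp_le_exp.2
    have e : -((n i : ℝ) * p i) / (1 - p i) = n i * (1 - (1 - p i)⁻¹) := by
      field_simp
      ring
    rw [e]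
    exact mul_le_mul_of_nonneg_left hlog (Nat.cast_nonneg _)
  · filter_upwards [hsmall] with i hi
    have h1 : 0 ≤ 1 - p i := by linarith
    have h2 : 1 - p i ≤ Real.exp (-(p i)) := Real.one_sub_le_exp_neg _
    calc (1 - p i) ^ (n i) ≤ Real.exp (-(p i)) ^ (n i) := pow_le_pow_left₀ h1 h2 _
      _ = Real.exp (-((n i : ℝ) * p i)) := by rw [← Real.exp_nat_mul]; ring_nf

/-- Local limit theorem: `p N` converges to the gamma distribution at the level of densities. -/
theorem tendsto_trialsPMF_div {ι : Type*} {l : Filter ι} {n : ι → ℕ} {p : ι → ℝ} {ν : ℝ}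
    {r : ℕ} (hr : 1 ≤ r) (hn : Tendsto n l atTop) (hp : Tendsto p l (𝓝[>] 0))
    (hnp : Tendsto (fun i => (n i : ℝ) * p i) l (𝓝 ν)) :
    Tendsto (fun i => trialsPMF r (p i) (n i) / p i) l (𝓝 (gammaDensity r ν)) := by
  obtain ⟨k, rfl⟩ : ∃ k, r = k + 1 := ⟨r - 1, by omega⟩
  have hp0 : Tendsto p l (𝓝 0) := hp.mono_right nhdsWithin_le_nhds
  have hn1 : Tendsto (fun i => n i - 1) l atTop := (tendsto_sub_atTop_nat 1).comp hn
  have h1 := (tendsto_choose_div_pow k).comp hn1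
  have h2 : Tendsto (fun i => ((n i - 1 : ℕ) : ℝ) * p i) l (𝓝 ν) := by
    have : Tendsto (fun i => (n i : ℝ) * p i - p i) l (𝓝 (ν - 0)) := hnp.sub hp0
    rw [sub_zero] at this
    refine this.congr' ?_
    filter_upwards [hn.eventually_ge_atTop 1] with i hi
    rw [Nat.cast_sub hi]
    push_cast
    ring
  have h3 := tendsto_one_sub_pow_exp hp hnp
  have h4 : Tendsto (fun i => (1 - p i) ^ (k + 1)) l (𝓝 1) := by
    have := ((tendsto_const_nhds (x := (1 : ℝ))).sub hp0).pow (k + 1)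
    simpa using this
  have h5 := (h1.mul (h2.pow k)).mul (h3.div h4 one_ne_zero)
  have e : 1 / (k.factorial : ℝ) * ν ^ k * (Real.exp (-ν) / 1) = gammaDensity (k + 1) ν := by
    simp only [gammaDensity, Nat.add_sub_cancel]
    ring
  rw [e] at h5
  refine h5.congr' ?_
  filter_upwards [hn.eventually_ge_atTop (k + 2), hp0.eventually (Iio_mem_nhds one_pos),
    hp.eventually self_mem_nhdsWithin] with i hi hi1 hi0
  have hi0 : 0 < p i := hi0
  have hi1 : p i < 1 := hi1
  have hq : (1 - p i) ≠ 0 := by linarith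
  have hm : ((n i - 1 : ℕ) : ℝ) ≠ 0 := by
    have : n i - 1 ≠ 0 := by omega
    exact_mod_cast this
  simp only [trialsPMF, Function.comp, Nat.add_sub_cancel, Pi.div_apply]
  rw [show (1 - p i) ^ n i = (1 - p i) ^ (n i - (k + 1)) * (1 - p i) ^ (k + 1) by
    rw [← pow_add]; congr 1; omega, mul_pow]
  field_simp
  rw [pow_succ]
  ring

/-! ### Sums as integrals of step functions -/

theorem tsum_eq_lintegral_floor (a : ℕ → ℝ≥0∞) :
    ∑' n, a n = ∫⁻ t in Set.Ioi (0 : ℝ), a ⌊t⌋₊ := by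
  have hmap : (volume.restrict (Set.Ici (0 : ℝ))).map (fun t : ℝ => ⌊t⌋₊) = Measure.count := by
    refine Measure.ext_of_singleton fun n => ?_
    rw [Measure.map_apply Nat.measurable_floor (measurableSet_singleton n), Measure.count_singleton,
      Measure.restrict_apply (Nat.measurable_floor (measurableSet_singleton n))]
    have : (fun t : ℝ => ⌊t⌋₊) ⁻¹' {n} ∩ Set.Ici 0 = Set.Ico (n : ℝ) (n + 1) := by
      ext t
      simp only [Set.mem_inter_iff, Set.mem_preimage, Set.mem_singleton_iff, Set.mem_Ici,
        Set.mem_Ico]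
      constructor
      · rintro ⟨h, h0⟩
        exact (Nat.floor_eq_iff h0).1 h
      · intro h
        have h0 : 0 ≤ t := (Nat.cast_nonneg n).trans h.1
        exact ⟨(Nat.floor_eq_iff h0).2 h, h0⟩
    rw [this]
    simp
  rw [← lintegral_count, ← hmap, lintegral_map (measurable_of_countable a) Nat.measurable_floor,
    setLIntegral_congr Ioi_ae_eq_Ici]

theorem lintegral_eq_mul_lintegral_div {F : ℝ → ℝ≥0∞} (hF : Measurable F) {c : ℝ} (hc : 0 < c) :
    ∫⁻ x, F x = ENNReal.ofReal c⁻¹ * ∫⁻ x, F (x / c) := by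
  have h := Real.map_volume_mul_left (inv_ne_zero hc.ne')
  have h2 : ∫⁻ x, F (x / c) = ∫⁻ x, F x ∂(volume.map (c⁻¹ * ·)) := by
    rw [lintegral_map hF (measurable_const_mul _)]
    simp only [div_eq_inv_mul]
  rw [h2, h, lintegral_smul_measure, inv_inv, abs_of_pos hc, smul_eq_mul, ← mul_assoc,
    ← ENNReal.ofReal_mul (inv_nonneg.2 hc.le), inv_mul_cancel₀ hc.ne', ENNReal.ofReal_one, one_mul]

/-- The risk as an integral over the rescaled number of trials `ν = n p`. -/
theorem nonrandomizedRisk_eq_lintegral (r : ℕ) (L : ℝ → ℝ) (g : ℕ → ℝ) {p : ℝ} (hp : 0 < p) :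
    nonrandomizedRisk r L g p = ∫⁻ ν in Set.Ioi (0 : ℝ), (Set.Ici r).indicator
      (fun n => ENNReal.ofReal (trialsPMF r p n / p) * ENNReal.ofReal (L (g n / p))) ⌊ν / p⌋₊ := by
  unfold nonrandomizedRisk
  rw [tsum_subtype (Set.Ici r)
    fun n => ENNReal.ofReal (trialsPMF r p n) * ENNReal.ofReal (L (g n / p)),
    tsum_eq_lintegral_floor, ← lintegral_indicator measurableSet_Ioi,
    lintegral_eq_mul_lintegral_div ?_ hp, ← lintegral_const_mul' _ _ ENNReal.ofReal_ne_top,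
    ← lintegral_indicator measurableSet_Ioi]
  · refine lintegral_congr fun ν => ?_
    by_cases hν : 0 < ν
    · have h1 : ν / p ∈ Set.Ioi (0 : ℝ) := div_pos hν hp
      rw [Set.indicator_of_mem h1, Set.indicator_of_mem (show ν ∈ Set.Ioi (0 : ℝ) from hν)]
      by_cases hn : ⌊ν / p⌋₊ ∈ Set.Ici r
      · rw [Set.indicator_of_mem hn, Set.indicator_of_mem hn, ← mul_assoc,
          ← ENNReal.ofReal_mul (inv_nonneg.2 hp.le), inv_mul_eq_div]
      · rw [Set.indicator_of_notMem hn, Set.indicator_of_notMem hn, mul_zero]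
    · have h1 : ν / p ∉ Set.Ioi (0 : ℝ) := fun h => hν ((div_pos_iff_of_pos_right hp).1 h)
      rw [Set.indicator_of_notMem h1, Set.indicator_of_notMem (show ν ∉ Set.Ioi (0 : ℝ) from hν),
        mul_zero]
  · exact Measurable.indicator ((measurable_of_countable ((Set.Ici r).indicator
      fun n => ENNReal.ofReal (trialsPMF r p n) * ENNReal.ofReal (L (g n / p)))).comp
        Nat.measurable_floor) measurableSet_Ioi

/-! ### Asymptotic risk of a non-randomized estimator -/

theorem trialsPMF_nonneg (r n : ℕ) {p : ℝ} (hp : 0 < p) (hp1 : p < 1) : 0 ≤ trialsPMF r p n := by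
  have : 0 ≤ 1 - p := by linarith
  unfold trialsPMF
  positivity

/-- The rescaled probability mass function is dominated by a multiple of its limit. The constant
absorbs the difference between the exponent `n - r` and `n + 1 ≥ ν / p`. -/
theorem trialsPMF_div_le {r n : ℕ} (hr : 1 ≤ r) (hn : r ≤ n) {p ν : ℝ} (hp : 0 < p) (hp1 : p < 1)
    (hν : 0 < ν) (h1 : n * p ≤ ν) (h2 : ν ≤ (n + 1) * p) :
    trialsPMF r p n / p ≤ Real.exp (r + 1) * gammaDensity r ν := by
  obtain ⟨k, rfl⟩ : ∃ k, r = k + 1 := ⟨r - 1, by omega⟩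
  have hq : 0 ≤ 1 - p := by linarith
  have hchoose : ((n - 1).choose k : ℝ) * p ^ k ≤ ν ^ k / k.factorial := by
    calc ((n - 1).choose k : ℝ) * p ^ k ≤ ((n - 1 : ℕ) : ℝ) ^ k / k.factorial * p ^ k := by
          gcongr
          exact Nat.choose_le_pow_div k (n - 1)
      _ = (((n - 1 : ℕ) : ℝ) * p) ^ k / k.factorial := by rw [mul_pow]; ring
      _ ≤ ν ^ k / k.factorial := by
          gcongr
          refine le_trans ?_ h1
          gcongr
          omega
  have hpow : (1 - p) ^ (n - (k + 1)) ≤ Real.exp ((k + 1 : ℕ) + 1) * Real.exp (-ν) := by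
    calc (1 - p) ^ (n - (k + 1)) ≤ Real.exp (-p) ^ (n - (k + 1)) :=
          pow_le_pow_left₀ hq (Real.one_sub_le_exp_neg _) _
      _ = Real.exp (((n - (k + 1) : ℕ) : ℝ) * -p) := by rw [← Real.exp_nat_mul]
      _ ≤ _ := by
          rw [← Real.exp_add, Nat.cast_sub hn]
          apply Real.exp_le_exp.2
          push_cast
          nlinarith [(Nat.cast_nonneg k : (0 : ℝ) ≤ k)]
  have e : trialsPMF (k + 1) p n / p = (n - 1).choose k * p ^ k * (1 - p) ^ (n - (k + 1)) := by
    simp only [trialsPMF, Nat.add_sub_cancel, pow_succ]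
    field_simp
  rw [e]
  calc _ ≤ ν ^ k / k.factorial * (Real.exp ((k + 1 : ℕ) + 1) * Real.exp (-ν)) := by
        gcongr
    _ = _ := by
        simp only [gammaDensity, Nat.add_sub_cancel]
        ring

theorem exists_bounds_mul_of_tendsto {r : ℕ} (hr : 1 ≤ r) {g : ℕ → ℝ}
    (hg : IsNonrandomizedEstimator r g) {Ω : ℝ} (hΩ : 0 < Ω)
    (hlim : Tendsto (fun n : ℕ => (n : ℝ) * g n) atTop (𝓝 Ω)) :
    ∃ c₁ c₂ : ℝ, 0 < c₁ ∧ 0 < c₂ ∧ ∀ n, r ≤ n → c₁ ≤ n * g n ∧ n * g n ≤ c₂ := by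
  obtain ⟨B, hB⟩ := hlim.bddAbove_range
  -- The limit is positive, so the inverses converge too, which gives a lower bound.
  obtain ⟨D, hD⟩ := (hlim.inv₀ hΩ.ne').bddAbove_range
  have key : ∀ n, r ≤ n → 0 < (n : ℝ) * g n := fun n hn => by
    have : 0 < n := by omega
    have h0 : (0 : ℝ) < n := by exact_mod_cast this
    exact mul_pos h0 (hg n hn)
  have hBn : ∀ n : ℕ, n * g n ≤ B := fun n => hB ⟨n, rfl⟩
  have hDn : ∀ n : ℕ, (n * g n)⁻¹ ≤ D := fun n => hD ⟨n, rfl⟩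
  have hD0 : 0 < D := (inv_pos.2 (key r le_rfl)).trans_le (hDn r)
  refine ⟨D⁻¹, B, inv_pos.2 hD0, (key r le_rfl).trans_le (hBn r), fun n hn => ⟨?_, hBn n⟩⟩
  exact inv_le_of_inv_le₀ (key n hn) (hDn n)

theorem tendsto_floor_div_mul {ν : ℝ} (hν : 0 < ν) :
    Tendsto (fun p : ℝ => ⌊ν / p⌋₊) (𝓝[>] 0) atTop ∧
      Tendsto (fun p : ℝ => (⌊ν / p⌋₊ : ℝ) * p) (𝓝[>] 0) (𝓝 ν) := by
  have h : Tendsto (fun p : ℝ => ν / p) (𝓝[>] 0) atTop := by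
    simp only [div_eq_mul_inv]
    exact tendsto_inv_nhdsGT_zero.const_mul_atTop hν
  refine ⟨tendsto_nat_floor_atTop.comp h, ?_⟩
  have h2 := ((tendsto_nat_floor_div_atTop (R := ℝ)).comp h).mul_const ν
  rw [one_mul] at h2
  refine h2.congr' ?_
  filter_upwards [self_mem_nhdsWithin] with p hp
  have hp : 0 < p := hp
  simp only [Function.comp]
  field_simp

/-- If `n g(n) → Ω`, then the risk of `g` converges to the asymptotic risk associated with `Ω`.
The risk is the integral over `ν` of its `n`-th term at `n = ⌊ν / p⌋`, divided by `p`, and dominated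
convergence applies. -/
theorem tendsto_nonrandomizedRisk {r : ℕ} (hr : 1 ≤ r) {L : ℝ → ℝ}
    (hL_var : HasLocallyBoundedVariation L) (hL_disc : HasFinitelyManyDiscontinuities L)
    (hL_growth : HasThetaGrowth r L) {g : ℕ → ℝ} (hg : IsNonrandomizedEstimator r g) {Ω : ℝ}
    (hΩ : 0 < Ω) (hlim : Tendsto (fun n : ℕ => (n : ℝ) * g n) atTop (𝓝 Ω)) :
    Tendsto (nonrandomizedRisk r L g) (𝓝[>] 0) (𝓝 (asymptoticRisk r L Ω)) := by
  obtain ⟨a, ha, hO0⟩ := hL_growth.isBigO_zero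
  obtain ⟨b, hb, hbr, hO1⟩ := hL_growth.isBigO_atTop hr
  obtain ⟨C, hC, hLC⟩ := exists_power_bound hL_var ha hb hO0 hO1
  obtain ⟨c₁, c₂, hc₁, hc₂, hgb⟩ := exists_bounds_mul_of_tendsto hr hg hΩ hlim
  rw [asymptoticRisk_eq r L hΩ]
  refine Tendsto.congr' (f₁ := fun p => ∫⁻ ν in Set.Ioi (0 : ℝ), (Set.Ici r).indicator
      (fun n => ENNReal.ofReal (trialsPMF r p n / p) * ENNReal.ofReal (L (g n / p))) ⌊ν / p⌋₊) ?_ ?_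
  · filter_upwards [self_mem_nhdsWithin] with p hp
    exact (nonrandomizedRisk_eq_lintegral r L g hp).symm
  set A := Real.exp (r + 1) * C * c₁ ^ (-a) with hA
  set B := Real.exp (r + 1) * C * (2 * c₂) ^ b with hB
  refine tendsto_lintegral_filter_of_dominated_convergence
    (fun ν => ENNReal.ofReal (gammaDensity r ν * (A * ν ^ a + B * ν ^ (-b)))) ?_ ?_
    (lintegral_gammaDensity_mul_rpow_ne_top hr ha hbr A B) ?_
  · exact Eventually.of_forall fun p => (measurable_of_countable ((Set.Ici r).indicator
      fun n => ENNReal.ofReal (trialsPMF r p n / p) * ENNReal.ofReal (L (g n / p)))).comp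
        (Nat.measurable_floor.comp (measurable_id.div_const p))
  · filter_upwards [Ioo_mem_nhdsGT (zero_lt_one (α := ℝ))] with p hp
    obtain ⟨hp, hp1⟩ := hp
    rw [ae_restrict_iff' measurableSet_Ioi]
    refine ae_of_all _ fun ν hν => ?_
    have hν : 0 < ν := hν
    set n := ⌊ν / p⌋₊ with hn_def
    by_cases hn : n ∈ Set.Ici r
    swap
    · rw [Set.indicator_of_notMem hn]
      exact zero_le
    rw [Set.indicator_of_mem hn]
    have hn : r ≤ n := hn
    have hn1 : (1 : ℝ) ≤ n := by exact_mod_cast hr.trans hn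
    have hle : (n : ℝ) * p ≤ ν := by
      have := Nat.floor_le (div_nonneg hν.le hp.le)
      rwa [← hn_def, le_div_iff₀ hp] at this
    have hge : ν ≤ (n + 1) * p := by
      have := (Nat.lt_floor_add_one (ν / p)).le
      rwa [← hn_def, div_le_iff₀ hp] at this
    have hf := trialsPMF_div_le hr hn hp hp1 hν hle hge
    rw [← ENNReal.ofReal_mul (div_nonneg (trialsPMF_nonneg r n hp hp1) hp.le)]
    apply ENNReal.ofReal_le_ofReal
    have hx : 0 < g n / p := div_pos (hg n hn) hp
    have hlow : c₁ / ν ≤ g n / p := by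
      rw [div_le_div_iff₀ hν hp]
      have := (hgb n hn).1
      have := hg n hn
      nlinarith
    have hupp : g n / p ≤ 2 * c₂ / ν := by
      rw [div_le_div_iff₀ hp hν]
      have h2 : ν ≤ 2 * (n * p) := by nlinarith
      have := (hgb n hn).2
      have := hg n hn
      nlinarith
    have hLx := hLC _ hx
    have e1 : (g n / p) ^ (-a) ≤ c₁ ^ (-a) * ν ^ a := by
      refine (Real.rpow_le_rpow_of_nonpos (div_pos hc₁ hν) hlow (neg_nonpos.2 ha)).trans_eq ?_
      rw [Real.div_rpow hc₁.le hν.le, Real.rpow_neg hν.le, div_inv_eq_mul]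
    have e2 : (g n / p) ^ b ≤ (2 * c₂) ^ b * ν ^ (-b) := by
      refine (Real.rpow_le_rpow hx.le hupp hb).trans_eq ?_
      rw [Real.div_rpow (by positivity) hν.le, Real.rpow_neg hν.le, div_eq_mul_inv]
    calc trialsPMF r p n / p * L (g n / p)
        ≤ trialsPMF r p n / p * (C * (c₁ ^ (-a) * ν ^ a + (2 * c₂) ^ b * ν ^ (-b))) := by
          refine mul_le_mul_of_nonneg_left (hLx.trans ?_)
            (div_nonneg (trialsPMF_nonneg r n hp hp1) hp.le)
          gcongr
      _ ≤ Real.exp (r + 1) * gammaDensity r ν *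
            (C * (c₁ ^ (-a) * ν ^ a + (2 * c₂) ^ b * ν ^ (-b))) := by
          gcongr
      _ = gammaDensity r ν * (A * ν ^ a + B * ν ^ (-b)) := by
          rw [hA, hB]
          ring
  · filter_upwards [ae_continuousAt_div hL_disc hΩ, ae_restrict_mem measurableSet_Ioi]
      with ν hcont hν
    have hν : 0 < ν := hν
    obtain ⟨hn, hnp⟩ := tendsto_floor_div_mul hν
    have h1 := ENNReal.tendsto_ofReal (tendsto_trialsPMF_div hr hn tendsto_id hnp)
    have h2 : Tendsto (fun p : ℝ => g ⌊ν / p⌋₊ / p) (𝓝[>] 0) (𝓝 (Ω / ν)) := by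
      refine ((hlim.comp hn).div hnp hν.ne').congr' ?_
      filter_upwards [hn.eventually_ge_atTop 1, self_mem_nhdsWithin] with p hn hp
      have hp : 0 < p := hp
      have : (⌊ν / p⌋₊ : ℝ) ≠ 0 := by
        have : ⌊ν / p⌋₊ ≠ 0 := by omega
        exact_mod_cast this
      simp only [Function.comp, Pi.div_apply]
      field_simp
    have h3 := (tendsto_posLoss (div_pos hΩ hν) hcont).comp h2
    refine Tendsto.congr' ?_ (ENNReal.Tendsto.mul h1 (Or.inr ?_) h3 (Or.inr ENNReal.ofReal_ne_top))
    · filter_upwards [hn.eventually_ge_atTop r, self_mem_nhdsWithin] with p hn hp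
      rw [Set.indicator_of_mem (show ⌊ν / p⌋₊ ∈ Set.Ici r from hn)]
      simp only [Function.comp, id]
      rw [posLoss_of_pos L (div_pos (hg _ hn) hp)]
    · rw [posLoss_of_pos L (div_pos hΩ hν)]
      exact ENNReal.ofReal_ne_top

/-! ### Asymptotic risk for small and for large arguments -/

/-- If the loss function tends to `c` along `l` (in practice `Ω → 0` or `Ω → ∞`), so does the
asymptotic risk, as the density integrates to one. -/
theorem tendsto_asymptoticRisk {r : ℕ} (hr : 1 ≤ r) {L : ℝ → ℝ}
    (hL_disc : HasFinitelyManyDiscontinuities L) {l : Filter ℝ} [l.IsCountablyGenerated]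
    (hl : ∀ᶠ Ω in l, 0 < Ω) (hdiv : ∀ ν : ℝ, 0 < ν → Tendsto (fun Ω => Ω / ν) l l)
    {c : ℝ≥0∞} (hc : c ≠ ⊤) (hlim : Tendsto (posLoss L) l (𝓝 c)) {A B a b : ℝ} (ha : 0 ≤ a)
    (hbr : b < r) (hdom : ∀ᶠ Ω in l, ∀ ν, 0 < ν → L (Ω / ν) ≤ A * ν ^ a + B * ν ^ (-b)) :
    Tendsto (asymptoticRisk r L) l (𝓝 c) := by
  have hconst : ∫⁻ ν in Set.Ioi 0, ENNReal.ofReal (gammaDensity r ν) * c = c := by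
    rw [lintegral_mul_const' _ _ hc, lintegral_gammaDensity hr, one_mul]
  rw [← hconst]
  refine Tendsto.congr' (f₁ := fun Ω =>
    ∫⁻ ν in Set.Ioi 0, ENNReal.ofReal (gammaDensity r ν) * posLoss L (Ω / ν)) ?_ ?_
  · filter_upwards [hl] with Ω hΩ
    exact (asymptoticRisk_eq r L hΩ).symm
  refine tendsto_lintegral_filter_of_dominated_convergence
    (fun ν => ENNReal.ofReal (gammaDensity r ν * (A * ν ^ a + B * ν ^ (-b)))) ?_ ?_
    (lintegral_gammaDensity_mul_rpow_ne_top hr ha hbr A B) ?_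
  · exact Eventually.of_forall fun Ω => (measurable_gammaDensity r).ennreal_ofReal.mul
      ((measurable_posLoss hL_disc).comp (measurable_const.div measurable_id))
  · filter_upwards [hdom, hl] with Ω hd hΩ
    rw [ae_restrict_iff' measurableSet_Ioi]
    refine ae_of_all _ fun ν hν => ?_
    have hν : 0 < ν := hν
    rw [posLoss_of_pos L (div_pos hΩ hν), ← ENNReal.ofReal_mul (gammaDensity_pos hν).le]
    exact ENNReal.ofReal_le_ofReal (mul_le_mul_of_nonneg_left (hd ν hν) (gammaDensity_pos hν).le)
  · rw [ae_restrict_iff' measurableSet_Ioi]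
    refine ae_of_all _ fun ν hν => ?_
    exact ENNReal.Tendsto.const_mul (hlim.comp (hdiv ν hν)) (Or.inr ENNReal.ofReal_ne_top)

theorem tendsto_div_const_nhdsGT_zero {ν : ℝ} (hν : 0 < ν) :
    Tendsto (fun Ω : ℝ => Ω / ν) (𝓝[>] 0) (𝓝[>] 0) := by
  refine tendsto_nhdsWithin_iff.2 ⟨?_, ?_⟩
  · have : Tendsto (fun Ω : ℝ => Ω / ν) (𝓝 0) (𝓝 (0 / ν)) := tendsto_id.div_const ν
    rw [zero_div] at this
    exact this.mono_left nhdsWithin_le_nhds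
  · filter_upwards [self_mem_nhdsWithin] with x hx
    exact div_pos hx hν

/-- The optimal asymptotic risk does not exceed the limit of the loss function at zero. -/
theorem IsOptimal.le_of_tendsto_zero {r : ℕ} (hr : 1 ≤ r) {L : ℝ → ℝ}
    (hL_nonneg : ∀ x : ℝ, 0 < x → 0 ≤ L x) (hL_var : HasLocallyBoundedVariation L)
    (hL_disc : HasFinitelyManyDiscontinuities L) (hL_growth : HasThetaGrowth r L) {Ω : ℝ}
    (hΩ : IsOptimal r L Ω) {c : ℝ≥0∞} (hlim : Tendsto (posLoss L) (𝓝[>] 0) (𝓝 c)) :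
    asymptoticRisk r L Ω ≤ c := by
  rcases eq_or_ne c ⊤ with rfl | hc
  · exact le_top
  obtain ⟨b, hb, hbr, hO1⟩ := hL_growth.isBigO_atTop hr
  have hO0 := isBigO_one_of_tendsto_posLoss (l := 𝓝[>] 0) hL_nonneg self_mem_nhdsWithin hc hlim
  obtain ⟨C, hC, hLC⟩ :=
    exists_power_bound hL_var le_rfl hb (by simpa only [neg_zero] using hO0) hO1
  refine ge_of_tendsto (tendsto_asymptoticRisk (l := 𝓝[>] 0) hr hL_disc self_mem_nhdsWithin
    (fun ν hν => tendsto_div_const_nhdsGT_zero hν) hc hlim le_rfl hbr (A := C) (B := C) ?_) ?_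
  · filter_upwards [Ioo_mem_nhdsGT (zero_lt_one (α := ℝ))] with ω hω ν hν
    refine (hLC _ (div_pos hω.1 hν)).trans ?_
    rw [← mul_add, neg_zero, Real.rpow_zero, Real.rpow_zero, Real.div_rpow hω.1.le hν.le,
      Real.rpow_neg hν.le, ← one_div]
    gcongr
    exact Real.rpow_le_one hω.1.le hω.2.le hb
  · filter_upwards [self_mem_nhdsWithin] with ω hω
    exact hΩ.2 hω

/-- The optimal asymptotic risk does not exceed the limit of the loss function at infinity. -/
theorem IsOptimal.le_of_tendsto_atTop {r : ℕ} (hr : 1 ≤ r) {L : ℝ → ℝ}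
    (hL_nonneg : ∀ x : ℝ, 0 < x → 0 ≤ L x) (hL_var : HasLocallyBoundedVariation L)
    (hL_disc : HasFinitelyManyDiscontinuities L) (hL_growth : HasThetaGrowth r L) {Ω : ℝ}
    (hΩ : IsOptimal r L Ω) {c : ℝ≥0∞} (hlim : Tendsto (posLoss L) atTop (𝓝 c)) :
    asymptoticRisk r L Ω ≤ c := by
  rcases eq_or_ne c ⊤ with rfl | hc
  · exact le_top
  obtain ⟨a, ha, hO0⟩ := hL_growth.isBigO_zero
  have hO1 := isBigO_one_of_tendsto_posLoss hL_nonneg (eventually_gt_atTop 0) hc hlim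
  obtain ⟨C, hC, hLC⟩ := exists_power_bound hL_var ha le_rfl hO0 hO1
  have hr0 : (0 : ℝ) < r := by exact_mod_cast hr
  refine ge_of_tendsto (tendsto_asymptoticRisk hr hL_disc (eventually_gt_atTop 0)
    (fun ν hν => tendsto_id.atTop_div_const hν) hc hlim ha hr0 (A := C) (B := C) ?_) ?_
  · filter_upwards [eventually_ge_atTop 1] with ω hω ν hν
    have hω0 : 0 < ω := by linarith
    refine (hLC _ (div_pos hω0 hν)).trans ?_
    rw [← mul_add, neg_zero, Real.rpow_zero, Real.rpow_zero, Real.rpow_neg (div_pos hω0 hν).le,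
      ← Real.inv_rpow (div_pos hω0 hν).le, inv_div]
    gcongr
    exact div_le_self hν.le hω
  · filter_upwards [eventually_gt_atTop 0] with ω hω
    exact hΩ.2 hω

/-! ### A lower bound uniform in the estimate -/

/-- Fatou's lemma for truncated Bayes risks. Here `ℓ` is the pointwise limit of the losses, which
is allowed to be infinite. -/
theorem lintegral_gammaDensity_mul_le_of_tendsto {r : ℕ} (hr : 1 ≤ r) {L : ℝ → ℝ}
    (hL_disc : HasFinitelyManyDiscontinuities L) {M n : ℕ → ℕ} {Ω : ℕ → ℝ} {c : ℝ≥0∞}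
    {ℓ : ℝ → ℝ≥0∞} (hM : Tendsto M atTop atTop) (hn : Tendsto n atTop atTop)
    (hℓ : ∀ᵐ ν ∂(volume.restrict (Set.Ioi (0 : ℝ))),
      Tendsto (fun j => posLoss L (Ω j / ν)) atTop (𝓝 (ℓ ν)))
    (hle : ∀ j, ∫⁻ ν in Set.Icc (1 / (M j : ℝ)) (M j),
      ENNReal.ofReal (trialsPMF r (ν / n j) (n j) / (ν / n j)) * posLoss L (Ω j / ν) ≤ c) :
    ∫⁻ ν in Set.Ioi 0, ENNReal.ofReal (gammaDensity r ν) * ℓ ν ≤ c := by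
  set F : ℕ → ℝ → ℝ≥0∞ := fun j => (Set.Icc (1 / (M j : ℝ)) (M j)).indicator fun ν =>
    ENNReal.ofReal (trialsPMF r (ν / n j) (n j) / (ν / n j)) * posLoss L (Ω j / ν) with hF
  have hmeas : ∀ j, Measurable (F j) := fun j => by
    have h1 := (measurable_trialsPMF_div r (n j)).comp (measurable_id.div_const (n j : ℝ))
    exact (h1.ennreal_ofReal.mul ((measurable_posLoss hL_disc).comp
      (measurable_const.div measurable_id))).indicator measurableSet_Icc
  have hFle : ∀ j, ∫⁻ ν in Set.Ioi 0, F j ν ≤ c := fun j =>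
    (setLIntegral_le_lintegral _ _).trans
      ((lintegral_indicator measurableSet_Icc _).trans_le (hle j))
  have hlim : ∀ᵐ ν ∂(volume.restrict (Set.Ioi (0 : ℝ))),
      Tendsto (fun j => F j ν) atTop (𝓝 (ENNReal.ofReal (gammaDensity r ν) * ℓ ν)) := by
    filter_upwards [hℓ, ae_restrict_mem measurableSet_Ioi] with ν hν hpos
    have hpos : 0 < ν := hpos
    have hnR : Tendsto (fun j => (n j : ℝ)) atTop atTop := tendsto_natCast_atTop_atTop.comp hn
    have hMR : Tendsto (fun j => (M j : ℝ)) atTop atTop := tendsto_natCast_atTop_atTop.comp hM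
    have hp : Tendsto (fun j => ν / n j) atTop (𝓝[>] 0) := by
      refine tendsto_nhdsWithin_iff.2 ⟨tendsto_const_nhds.div_atTop hnR, ?_⟩
      filter_upwards [hnR.eventually_gt_atTop 0] with j hj
      exact div_pos hpos hj
    have hnp : Tendsto (fun j => (n j : ℝ) * (ν / n j)) atTop (𝓝 ν) := by
      refine tendsto_const_nhds.congr' ?_
      filter_upwards [hnR.eventually_gt_atTop 0] with j hj
      field_simp
    have h1 := ENNReal.tendsto_ofReal (tendsto_trialsPMF_div hr hn hp hnp)
    have h0 : ENNReal.ofReal (gammaDensity r ν) ≠ 0 :=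
      (ENNReal.ofReal_pos.2 (gammaDensity_pos hpos)).ne'
    refine (ENNReal.Tendsto.mul h1 (Or.inl h0) hν (Or.inr ENNReal.ofReal_ne_top)).congr' ?_
    filter_upwards [hMR.eventually_ge_atTop ν, hMR.eventually_ge_atTop (1 / ν)] with j h2 h3
    have hMpos : (0 : ℝ) < M j := hpos.trans_le h2
    simp only [hF]
    rw [Set.indicator_of_mem]
    exact ⟨(one_div_le hMpos hpos).2 h3, h2⟩
  calc ∫⁻ ν in Set.Ioi 0, ENNReal.ofReal (gammaDensity r ν) * ℓ ν
      = ∫⁻ ν in Set.Ioi 0, liminf (fun j => F j ν) atTop :=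
        lintegral_congr_ae (hlim.mono fun ν h => h.liminf_eq.symm)
    _ ≤ liminf (fun j => ∫⁻ ν in Set.Ioi 0, F j ν) atTop := lintegral_liminf_le hmeas
    _ ≤ c := by
        refine (liminf_le_liminf (Eventually.of_forall hFle)).trans ?_
        simp

/-- The integral below is `n` times the contribution of `N = n` to the Bayes risk of the estimate
`y = Ω / n` under the improper prior `dp / p`, restricted to `ν = n p ∈ [1/M, M]`. It is almost as
large as the optimal asymptotic risk, uniformly in `Ω` and in large `n`. Uniformity comes from compactness of `[0, ∞]`: the limits
`Ω → 0` and `Ω → ∞` are harmless because the loss function has limits there which are no smaller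
than the optimal risk. -/
theorem exists_uniform_truncation {r : ℕ} (hr : 1 ≤ r) {L : ℝ → ℝ}
    (hL_nonneg : ∀ x : ℝ, 0 < x → 0 ≤ L x) (hL_var : HasLocallyBoundedVariation L)
    (hL_disc : HasFinitelyManyDiscontinuities L) (hL_growth : HasThetaGrowth r L)
    (hL_start : HasDecreasingStart r L) (hL_end : HasIncreasingEnd L) {Ωopt : ℝ}
    (hΩ : IsOptimal r L Ωopt) {c : ℝ≥0∞} (hc : c < asymptoticRisk r L Ωopt) :
    ∃ M n₀ : ℕ, 1 ≤ M ∧ ∀ n, n₀ ≤ n → ∀ Ω : ℝ, 0 < Ω →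
      c ≤ ∫⁻ ν in Set.Icc (1 / (M : ℝ)) M,
        ENNReal.ofReal (trialsPMF r (ν / n) n / (ν / n)) * posLoss L (Ω / ν) := by
  by_contra! hcon
  choose n hn Ω hΩpos hlt using fun k : ℕ => hcon (k + 1) k (by omega)
  obtain ⟨ω, φ, hφ, hω⟩ := CompactSpace.tendsto_subseq fun k => ENNReal.ofReal (Ω k)
  have hM : Tendsto (fun j => φ j + 1) atTop atTop :=
    (tendsto_add_atTop_nat 1).comp hφ.tendsto_atTop
  have hnt : Tendsto (fun j => n (φ j)) atTop atTop :=
    (tendsto_atTop_mono hn tendsto_id).comp hφ.tendsto_atTop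
  have fatou : ∀ ℓ : ℝ → ℝ≥0∞, (∀ᵐ ν ∂(volume.restrict (Set.Ioi (0 : ℝ))),
      Tendsto (fun j => posLoss L (Ω (φ j) / ν)) atTop (𝓝 (ℓ ν))) →
      ∫⁻ ν in Set.Ioi 0, ENNReal.ofReal (gammaDensity r ν) * ℓ ν ≤ c := fun ℓ hℓ =>
    lintegral_gammaDensity_mul_le_of_tendsto hr hL_disc hM hnt hℓ fun j => (hlt (φ j)).le
  have fatou_const : ∀ l : ℝ≥0∞, asymptoticRisk r L Ωopt ≤ l →
      (∀ ν : ℝ, 0 < ν → Tendsto (fun j => posLoss L (Ω (φ j) / ν)) atTop (𝓝 l)) → False := by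
    intro l hl hlim
    have h := fatou (fun _ => l)
      ((ae_restrict_iff' measurableSet_Ioi).2 (ae_of_all _ fun ν hν => hlim ν hν))
    rw [lintegral_mul_const _ (measurable_gammaDensity r).ennreal_ofReal,
      lintegral_gammaDensity hr, one_mul] at h
    exact absurd (hl.trans h) (not_le.2 hc)
  -- In each case Fatou's lemma yields a limit risk that is at most `c` and at least the optimal one.
  rcases eq_or_ne ω ⊤ with rfl | hωtop
  · obtain ⟨l, hl⟩ := exists_tendsto_posLoss_atTop hL_end
    refine fatou_const l (hΩ.le_of_tendsto_atTop hr hL_nonneg hL_var hL_disc hL_growth hl)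
      fun ν hν => hl.comp (Tendsto.atTop_div_const hν ?_)
    exact ENNReal.tendsto_ofReal_nhds_top.1 hω
  have hreal : Tendsto (fun j => Ω (φ j)) atTop (𝓝 ω.toReal) := by
    refine ((ENNReal.tendsto_toReal hωtop).comp hω).congr fun j => ?_
    exact ENNReal.toReal_ofReal (hΩpos _).le
  rcases (ENNReal.toReal_nonneg (a := ω)).eq_or_lt with h0 | hpos
  · rw [← h0] at hreal
    obtain ⟨l, hl⟩ := exists_tendsto_posLoss_zero hL_start
    refine fatou_const l (hΩ.le_of_tendsto_zero hr hL_nonneg hL_var hL_disc hL_growth hl)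
      fun ν hν => hl.comp ((tendsto_div_const_nhdsGT_zero hν).comp ?_)
    exact tendsto_nhdsWithin_iff.2 ⟨hreal, Eventually.of_forall fun j => hΩpos _⟩
  · have h := fatou (fun ν => posLoss L (ω.toReal / ν)) (by
      filter_upwards [ae_continuousAt_div hL_disc hpos, ae_restrict_mem measurableSet_Ioi]
        with ν hν hν0
      exact (tendsto_posLoss (div_pos hpos hν0) hν).comp (hreal.div_const ν))
    rw [← asymptoticRisk_eq r L hpos] at h
    exact absurd ((hΩ.2 hpos).trans h) (not_le.2 hc)

/-! ### Averaging the risk over the success probability -/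

/-- The contribution of `N = n` to the risk of `G` at `p`, multiplied by the density `1 / p` of the
improper prior. -/
noncomputable def priorRiskTerm (r : ℕ) (L : ℝ → ℝ) (G : ℕ → Measure ℝ) (n : ℕ) (p : ℝ) : ℝ≥0∞ :=
  ENNReal.ofReal (trialsPMF r p n / p) * ∫⁻ y in Set.Ioi 0, posLoss L (y / p) ∂(G n)

theorem measurable_priorRiskTerm {r : ℕ} {L : ℝ → ℝ} (hL_disc : HasFinitelyManyDiscontinuities L)
    {G : ℕ → Measure ℝ} (hG : IsEstimator r G) {n : ℕ} (hn : r ≤ n) :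
    Measurable (priorRiskTerm r L G n) := by
  have := (hG n hn).1
  refine (measurable_trialsPMF_div r n).ennreal_ofReal.mul ?_
  exact Measurable.lintegral_prod_right'
    (f := fun q : ℝ × ℝ => posLoss L (q.2 / q.1))
    ((measurable_posLoss hL_disc).comp (measurable_snd.div measurable_fst))

/-- The substitution `p = ν / n`. -/
theorem mul_lintegral_Icc_div {F : ℝ → ℝ≥0∞} (hF : Measurable F) {n : ℝ} (hn : 0 < n)
    (M : ℝ) :
    ENNReal.ofReal n⁻¹ * ∫⁻ ν in Set.Icc (1 / M) M, F (ν / n) =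
      ∫⁻ p in Set.Icc (1 / (M * n)) (M / n), F p := by
  rw [← lintegral_indicator measurableSet_Icc, ← lintegral_indicator measurableSet_Icc,
    lintegral_eq_mul_lintegral_div (hF.indicator measurableSet_Icc) hn]
  congr 1
  refine lintegral_congr fun ν => ?_
  have hiff : ν / n ∈ Set.Icc (1 / (M * n)) (M / n) ↔ ν ∈ Set.Icc (1 / M) M := by
    rw [Set.mem_Icc, Set.mem_Icc, ← div_div, div_le_div_iff_of_pos_right hn,
      div_le_div_iff_of_pos_right hn]
  by_cases h : ν ∈ Set.Icc (1 / M) M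
  · rw [Set.indicator_of_mem h, Set.indicator_of_mem (hiff.2 h)]
  · rw [Set.indicator_of_notMem h, Set.indicator_of_notMem (fun h' => h (hiff.1 h'))]

/-- A lower bound for the Bayes risk of every single estimate extends to randomized ones, by
Tonelli's theorem. -/
theorem mul_inv_le_lintegral_priorRiskTerm {r : ℕ} {L : ℝ → ℝ}
    (hL_disc : HasFinitelyManyDiscontinuities L) {G : ℕ → Measure ℝ} (hG : IsEstimator r G)
    {n : ℕ} (hn : r ≤ n) (hn0 : 0 < n) {M : ℝ} {c : ℝ≥0∞}
    (hc : ∀ Ω : ℝ, 0 < Ω → c ≤ ∫⁻ ν in Set.Icc (1 / M) M,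
        ENNReal.ofReal (trialsPMF r (ν / n) n / (ν / n)) * posLoss L (Ω / ν)) :
    c * ENNReal.ofReal (n : ℝ)⁻¹ ≤
      ∫⁻ p in Set.Icc (1 / (M * n)) (M / n), priorRiskTerm r L G n p := by
  have := (hG n hn).1
  have hnR : (0 : ℝ) < n := by exact_mod_cast hn0
  have hmass : G n (Set.Ioi 0) = 1 := by
    have h := (prob_compl_eq_one_iff (μ := G n) (measurableSet_Iic (a := (0 : ℝ)))).2 (hG n hn).2
    rwa [Set.compl_Iic] at h
  have hpost : ∀ y : ℝ, 0 < y → c * ENNReal.ofReal (n : ℝ)⁻¹ ≤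
      ∫⁻ p in Set.Icc (1 / (M * n)) (M / n),
        ENNReal.ofReal (trialsPMF r p n / p) * posLoss L (y / p) := by
    intro y hy
    rw [← mul_lintegral_Icc_div ?_ hnR M, mul_comm]
    · refine mul_le_mul_right ((hc (y * n) (mul_pos hy hnR)).trans_eq ?_) _
      refine lintegral_congr fun ν => ?_
      rw [div_div_eq_mul_div y]
    · exact (measurable_trialsPMF_div r n).ennreal_ofReal.mul
        ((measurable_posLoss hL_disc).comp (measurable_const.div measurable_id))
  calc c * ENNReal.ofReal (n : ℝ)⁻¹
      = ∫⁻ _ in Set.Ioi 0, c * ENNReal.ofReal (n : ℝ)⁻¹ ∂(G n) := by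
        rw [setLIntegral_const, hmass, mul_one]
    _ ≤ ∫⁻ y in Set.Ioi 0, (∫⁻ p in Set.Icc (1 / (M * n)) (M / n),
          ENNReal.ofReal (trialsPMF r p n / p) * posLoss L (y / p)) ∂(G n) :=
        setLIntegral_mono' measurableSet_Ioi hpost
    _ = ∫⁻ p in Set.Icc (1 / (M * n)) (M / n), ∫⁻ y in Set.Ioi 0,
          ENNReal.ofReal (trialsPMF r p n / p) * posLoss L (y / p) ∂(G n) := by
        refine lintegral_lintegral_swap (Measurable.aemeasurable ?_)
        exact ((measurable_trialsPMF_div r n).ennreal_ofReal.comp measurable_snd).mul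
          ((measurable_posLoss hL_disc).comp (measurable_fst.div measurable_snd))
    _ = _ := by
        refine lintegral_congr fun p => ?_
        exact lintegral_const_mul' _ _ ENNReal.ofReal_ne_top

theorem sum_priorRiskTerm_le {r : ℕ} {L : ℝ → ℝ} {G : ℕ → Measure ℝ} {p : ℝ} (hp : 0 < p)
    {s : Finset ℕ} (hs : ∀ n ∈ s, r ≤ n) :
    ∑ n ∈ s, priorRiskTerm r L G n p ≤ ENNReal.ofReal p⁻¹ * risk r L G p := by
  unfold risk
  rw [tsum_subtype (Set.Ici r) fun n => ENNReal.ofReal (trialsPMF r p n) *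
    ∫⁻ y in Set.Ioi 0, ENNReal.ofReal (L (y / p)) ∂(G n)]
  refine le_trans (le_of_eq ?_) (mul_le_mul_right (ENNReal.sum_le_tsum s) _)
  rw [Finset.mul_sum]
  refine Finset.sum_congr rfl fun n hn => ?_
  rw [Set.indicator_of_mem (show n ∈ Set.Ici r from hs n hn), ← mul_assoc,
    ← ENNReal.ofReal_mul (inv_nonneg.2 hp.le), inv_mul_eq_div, priorRiskTerm]
  congr 1
  exact setLIntegral_congr_fun measurableSet_Ioi fun y hy => posLoss_of_pos L (div_pos hy hp)

theorem lintegral_Icc_inv {α β : ℝ} (hα : 0 < α) (hαβ : α ≤ β) :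
    ∫⁻ p in Set.Icc α β, ENNReal.ofReal p⁻¹ = ENNReal.ofReal (Real.log (β / α)) := by
  have hint : IntegrableOn (fun p : ℝ => p⁻¹) (Set.Icc α β) :=
    ContinuousOn.integrableOn_Icc (continuousOn_inv₀.mono fun p hp => (hα.trans_le hp.1).ne')
  rw [← ofReal_integral_eq_lintegral_ofReal hint, integral_Icc_eq_integral_Ioc,
    ← intervalIntegral.integral_of_le hαβ, integral_inv_of_pos hα (hα.trans_le hαβ)]
  exact (ae_restrict_iff' measurableSet_Icc).2
    (ae_of_all _ fun p hp => inv_nonneg.2 (hα.le.trans hp.1))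

theorem log_div_le_sum_inv {A N : ℕ} (hA : 0 < A) (hN : A ≤ N) :
    Real.log ((N : ℝ) / A) ≤ ∑ n ∈ Finset.Ico A N, (n : ℝ)⁻¹ := by
  have hA' : (0 : ℝ) < A := by exact_mod_cast hA
  induction N, hN using Nat.le_induction with
  | base => simp [hA'.ne']
  | succ N hN ih =>
    have hN' : (0 : ℝ) < N := by exact_mod_cast hA.trans_le hN
    rw [Finset.sum_Ico_succ_top hN]
    have e : ((N + 1 : ℕ) : ℝ) / A = N / A * (1 + (N : ℝ)⁻¹) := by
      push_cast
      field_simp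
    rw [e, Real.log_mul (by positivity) (by positivity)]
    have := Real.log_le_sub_one_of_pos (show 0 < 1 + (N : ℝ)⁻¹ by positivity)
    linarith

/-- A lower bound for the Bayes risk given `N = n`, valid for all large `n` and all estimates,
passes to the limit superior of the risk: the prior `dp / p` restricted to `[1/(MN), M/A]` has mass
`log (N/A) + 2 log M`, while the values `A ≤ n < N` contribute at least `c ∑ 1/n ≥ c log (N/A)` to
the averaged risk. -/
theorem le_limsup_risk {r : ℕ} {L : ℝ → ℝ}
    (hL_disc : HasFinitelyManyDiscontinuities L) {G : ℕ → Measure ℝ} (hG : IsEstimator r G)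
    {M n₀ : ℕ} (hM : 1 ≤ M) {c : ℝ≥0∞} (hctop : c ≠ ⊤)
    (hc : ∀ n, n₀ ≤ n → ∀ Ω : ℝ, 0 < Ω → c ≤ ∫⁻ ν in Set.Icc (1 / (M : ℝ)) M,
        ENNReal.ofReal (trialsPMF r (ν / n) n / (ν / n)) * posLoss L (Ω / ν)) :
    c ≤ limsupAtZero (risk r L G) := by
  by_contra! hlt
  obtain ⟨B, hB1, hBc⟩ := exists_between hlt
  have hBtop : B ≠ ⊤ := (hBc.trans_le le_top).ne
  obtain ⟨δ, hδ, hR⟩ := (nhdsGT_basis (0 : ℝ)).eventually_iff.1 (eventually_lt_of_limsup_lt hB1)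
  have hM0 : (0 : ℝ) < M := by exact_mod_cast hM
  have hM1 : (1 : ℝ) ≤ M := by exact_mod_cast hM
  obtain ⟨A, hAδ, hAmax⟩ := (((tendsto_const_div_atTop_nhds_zero_nat (M : ℝ)).eventually
    (Iio_mem_nhds hδ)).and (eventually_ge_atTop (max (max n₀ r) 1))).exists
  have hAn₀ : n₀ ≤ A := by omega
  have hAr : r ≤ A := by omega
  have hA : 0 < A := by omega
  have hA0 : (0 : ℝ) < A := by exact_mod_cast hA
  have key : ∀ N, A ≤ N →
      c.toReal * Real.log ((N : ℝ) / A) ≤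
        B.toReal * (Real.log ((N : ℝ) / A) + Real.log ((M : ℝ) * M)) := by
    intro N hN
    have hN0 : (0 : ℝ) < N := by exact_mod_cast hA.trans_le hN
    have hAN : (A : ℝ) ≤ N := by exact_mod_cast hN
    set I := Set.Icc (1 / ((M : ℝ) * N)) ((M : ℝ) / A) with hI
    have hα : 0 < 1 / ((M : ℝ) * N) := by positivity
    have hαβ : 1 / ((M : ℝ) * N) ≤ (M : ℝ) / A := by
      rw [div_le_div_iff₀ (by positivity) hA0, one_mul]
      nlinarith [mul_le_mul hM1 hM1 zero_le_one hM0.le]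
    have hIpos : ∀ p ∈ I, 0 < p := fun p hp => hα.trans_le hp.1
    have hsum : c * ENNReal.ofReal (∑ n ∈ Finset.Ico A N, (n : ℝ)⁻¹) ≤
        B * ENNReal.ofReal (Real.log ((M : ℝ) / A / (1 / ((M : ℝ) * N)))) := by
      calc c * ENNReal.ofReal (∑ n ∈ Finset.Ico A N, (n : ℝ)⁻¹)
          = ∑ n ∈ Finset.Ico A N, c * ENNReal.ofReal (n : ℝ)⁻¹ := by
            rw [ENNReal.ofReal_sum_of_nonneg fun n _ => by positivity, Finset.mul_sum]
        _ ≤ ∑ n ∈ Finset.Ico A N, ∫⁻ p in I, priorRiskTerm r L G n p := by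
            refine Finset.sum_le_sum fun n hn => ?_
            obtain ⟨h1, h2⟩ := Finset.mem_Ico.1 hn
            have hn0 : 0 < n := hA.trans_le h1
            have hn0' : (0 : ℝ) < n := by exact_mod_cast hn0
            refine (mul_inv_le_lintegral_priorRiskTerm hL_disc hG (hAr.trans h1) hn0
              (hc n (hAn₀.trans h1))).trans (lintegral_mono_set (Set.Icc_subset_Icc ?_ ?_))
            · gcongr
            · gcongr
        _ = ∫⁻ p in I, ∑ n ∈ Finset.Ico A N, priorRiskTerm r L G n p := by
            rw [lintegral_finsetSum']
            intro n hn
            exact (measurable_priorRiskTerm hL_disc hG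
              (hAr.trans (Finset.mem_Ico.1 hn).1)).aemeasurable
        _ ≤ ∫⁻ p in I, B * ENNReal.ofReal p⁻¹ := by
            refine setLIntegral_mono' measurableSet_Icc fun p hp => ?_
            refine (sum_priorRiskTerm_le (hIpos p hp) fun n hn =>
              hAr.trans (Finset.mem_Ico.1 hn).1).trans ?_
            rw [mul_comm]
            exact mul_le_mul_left (hR ⟨hIpos p hp, hp.2.trans_lt hAδ⟩).le _
        _ = _ := by
            rw [lintegral_const_mul' _ _ hBtop, lintegral_Icc_inv hα hαβ]
    have hlog0 : 0 ≤ Real.log ((N : ℝ) / A) := Real.log_nonneg ((one_le_div hA0).2 hAN)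
    have hlogM : 0 ≤ Real.log ((M : ℝ) * M) := Real.log_nonneg (by nlinarith)
    have e : (M : ℝ) / A / (1 / ((M : ℝ) * N)) = N / A * (M * M) := by
      field_simp
    rw [e, Real.log_mul (by positivity) (by positivity)] at hsum
    have h2 := (mul_le_mul_right (ENNReal.ofReal_le_ofReal (log_div_le_sum_inv hA hN)) c).trans hsum
    have h3 := ENNReal.toReal_mono (ENNReal.mul_ne_top hBtop ENNReal.ofReal_ne_top) h2
    rwa [ENNReal.toReal_mul, ENNReal.toReal_mul, ENNReal.toReal_ofReal hlog0,
      ENNReal.toReal_ofReal (add_nonneg hlog0 hlogM)] at h3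
  have hBc' : B.toReal < c.toReal := (ENNReal.toReal_lt_toReal hBtop hctop).2 hBc
  have hlogtop : Tendsto (fun N : ℕ => (c.toReal - B.toReal) * Real.log ((N : ℝ) / A)) atTop atTop :=
    (Real.tendsto_log_atTop.comp
      (tendsto_natCast_atTop_atTop.atTop_div_const hA0)).const_mul_atTop (sub_pos.2 hBc')
  -- As `N → ∞`, the bounded term `2 log M` cannot make up for `B < c`.
  obtain ⟨N, hN1, hN2⟩ := ((hlogtop.eventually_gt_atTop
    (B.toReal * Real.log ((M : ℝ) * M))).and (eventually_ge_atTop A)).exists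
  have := key N hN2
  linarith

end InverseBinomial

open InverseBinomial in
theorem mainTheorem4 (r : ℕ) (hr : 1 ≤ r) (L : ℝ → ℝ)
    (hL_nonneg : ∀ x : ℝ, 0 < x → 0 ≤ L x)
    (hL_var : InverseBinomial.HasLocallyBoundedVariation L)
    (hL_disc : InverseBinomial.HasFinitelyManyDiscontinuities L)
    (hL_growth : InverseBinomial.HasThetaGrowth r L)
    (hL_start : InverseBinomial.HasDecreasingStart r L)
    (hL_end : InverseBinomial.HasIncreasingEnd L)
    (Ωopt : ℝ) (hΩ : InverseBinomial.IsOptimal r L Ωopt)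
    (g : ℕ → ℝ) (hg : InverseBinomial.IsNonrandomizedEstimator r g)
    (hlim : Tendsto (fun n : ℕ => (n : ℝ) * g n) atTop (𝓝 Ωopt)) :
    IsLeast {s : ℝ≥0∞ | ∃ G : ℕ → Measure ℝ, InverseBinomial.IsEstimator r G ∧
        s = InverseBinomial.limsupAtZero (InverseBinomial.risk r L G)}
      (InverseBinomial.limsupAtZero (InverseBinomial.nonrandomizedRisk r L g)) := by
  refine ⟨⟨fun n => Measure.dirac (g n), hg.isEstimator_dirac, ?_⟩, ?_⟩
  · exact congrArg _ (funext fun p => (risk_dirac hg L p).symm)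
  rintro s ⟨G, hG, rfl⟩
  have hrisk : limsupAtZero (nonrandomizedRisk r L g) = asymptoticRisk r L Ωopt :=
    (tendsto_nonrandomizedRisk hr hL_var hL_disc hL_growth hg hΩ.1 hlim).limsup_eq
  rw [hrisk]
  refine le_of_forall_lt_imp_le_of_dense fun c hc => ?_
  obtain ⟨M, n₀, hM, hM'⟩ := exists_uniform_truncation hr hL_nonneg hL_var hL_disc hL_growth
    hL_start hL_end hΩ hc
  exact le_limsup_risk hL_disc hG hM (hc.trans_le le_top).ne hM'
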